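/- Let $0<\alpha<1$. For a measurable function $\psi:[0,1]\to[0,1]$ let $V_\psi$ be the bounded operator on the complex Hilbert space $L^2(0,1)$ given by $(V_\psi f)(x)=\int_0^{\psi(x)}f(t)\,dt$. Put $\phi(x)=1-(1-x)^{1/\alpha}$ for $x\in[0,1]$. Then $(Uf)(x)=f(1-x)$ defines a unitary operator $U$ on $L^2(0,1)$ and $$V_{x^\alpha}^*=U^{-1}V_\phi U ,$$ so that $V_{x^\alpha}^*$ and $V_\phi$ are unitarily equivalent; and the point spectrum (the set of eigenvalues) of $V_\phi$ is $$\sigma_p(V_\phi)=\{(1-\alpha)\alpha^{n-1}: n=1,2,3,\dots\}.$$ -/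

import Mathlib

open MeasureTheory Set

noncomputable section

/-- Lebesgue measure on the interval `(0,1)`. -/
abbrev muI : Measure ℝ := volume.restrict (Ioo (0 : ℝ) 1)

/-- The complex Hilbert space `L²(0,1)`. -/
abbrev L2I : Type := Lp ℂ 2 muI

/-- The function `x ↦ ∫_0^{φ(x)} f(t) dt`. -/
def volterraFun (φ : ℝ → ℝ) (f : ℝ → ℂ) (x : ℝ) : ℂ := ∫ t in (0 : ℝ)..(φ x), f t

theorem muI_univ : muI univ = 1 := by
  simp [muI]

instance : IsProbabilityMeasure muI := ⟨muI_univ⟩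

theorem restrict_Ioc_eq_muI : volume.restrict (Ioc (0 : ℝ) 1) = muI :=
  (Measure.restrict_congr_set Ioo_ae_eq_Ioc).symm

theorem L2I_integrable (f : L2I) : Integrable (f : ℝ → ℂ) muI :=
  (Lp.memLp f).integrable (by norm_num)

theorem L2I_integrableOn (f : L2I) : IntegrableOn (f : ℝ → ℂ) (Ioc 0 1) volume := by
  rw [IntegrableOn, restrict_Ioc_eq_muI]
  exact L2I_integrable f

theorem L2I_intervalIntegrable (f : L2I) {y : ℝ} (hy : y ∈ Icc (0 : ℝ) 1) :
    IntervalIntegrable (f : ℝ → ℂ) volume 0 y :=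
  (intervalIntegrable_iff_integrableOn_Ioc_of_le hy.1).2
    ((L2I_integrableOn f).mono_set (Ioc_subset_Ioc_right hy.2))

theorem volterraFun_congr {φ : ℝ → ℝ} (hφ : MapsTo φ (Icc 0 1) (Icc 0 1)) {f g : ℝ → ℂ}
    (h : f =ᵐ[muI] g) {x : ℝ} (hx : x ∈ Icc (0 : ℝ) 1) :
    volterraFun φ f x = volterraFun φ g x := by
  have hy := hφ hx
  unfold volterraFun
  rw [intervalIntegral.integral_of_le hy.1, intervalIntegral.integral_of_le hy.1]
  refine integral_congr_ae ?_
  rw [← restrict_Ioc_eq_muI] at h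
  exact ae_mono (Measure.restrict_mono (Ioc_subset_Ioc_right hy.2) le_rfl) h

theorem L2I_integral_norm_le (f : L2I) : ∫ t, ‖f t‖ ∂muI ≤ ‖f‖ := by
  rw [integral_norm_eq_lintegral_enorm (Lp.aestronglyMeasurable f), Lp.norm_def,
    ← eLpNorm_one_eq_lintegral_enorm]
  exact ENNReal.toReal_mono (Lp.eLpNorm_ne_top f)
    (eLpNorm_le_eLpNorm_of_exponent_le (by norm_num) (Lp.aestronglyMeasurable f))

theorem norm_volterraFun_le {φ : ℝ → ℝ} (hφ : MapsTo φ (Icc 0 1) (Icc 0 1)) (f : L2I)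
    {x : ℝ} (hx : x ∈ Icc (0 : ℝ) 1) : ‖volterraFun φ f x‖ ≤ ‖f‖ := by
  have hy := hφ hx
  refine le_trans ?_ (L2I_integral_norm_le f)
  unfold volterraFun
  rw [intervalIntegral.integral_of_le hy.1]
  refine (norm_integral_le_integral_norm _).trans ?_
  have h : ∫ t in Ioc 0 (φ x), ‖f t‖ ≤ ∫ t in Ioc 0 1, ‖f t‖ :=
    setIntegral_mono_set (L2I_integrableOn f).norm
      (Filter.Eventually.of_forall fun _ => norm_nonneg _)
      (Ioc_subset_Ioc_right hy.2).eventuallyLE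
  exact h.trans_eq (congrArg (fun m : Measure ℝ => ∫ t, ‖(f : ℝ → ℂ) t‖ ∂m) restrict_Ioc_eq_muI)

theorem ae_mem_Icc_muI : ∀ᵐ x ∂muI, x ∈ Icc (0 : ℝ) 1 :=
  (ae_restrict_mem measurableSet_Ioo).mono fun _ hx => Ioo_subset_Icc_self hx

theorem aestronglyMeasurable_volterraFun {φ : ℝ → ℝ} (hm : Measurable φ)
    (hφ : MapsTo φ (Icc 0 1) (Icc 0 1)) (f : L2I) :
    AEStronglyMeasurable (volterraFun φ f) muI := by
  set g : ℝ → ℂ := (Ioc (0 : ℝ) 1).indicator f with hg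
  have hgi : Integrable g volume := (L2I_integrableOn f).integrable_indicator measurableSet_Ioc
  have hc : Continuous fun y : ℝ => ∫ t in (0 : ℝ)..y, g t :=
    intervalIntegral.continuous_primitive (fun a b => hgi.intervalIntegrable) 0
  have hfg : (f : ℝ → ℂ) =ᵐ[muI] g := by
    filter_upwards [ae_restrict_mem (μ := volume) (measurableSet_Ioo (a := (0 : ℝ)) (b := 1))]
      with x hx
    rw [hg, indicator_of_mem (Ioo_subset_Ioc_self hx)]
  have hs : StronglyMeasurable (volterraFun φ g) := hc.stronglyMeasurable.comp_measurable hm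
  refine hs.aestronglyMeasurable.congr ?_
  filter_upwards [ae_mem_Icc_muI] with x hx
  exact (volterraFun_congr hφ hfg hx).symm

theorem memLp_volterraFun {φ : ℝ → ℝ} (hm : Measurable φ)
    (hφ : MapsTo φ (Icc 0 1) (Icc 0 1)) (f : L2I) : MemLp (volterraFun φ f) 2 muI :=
  MemLp.of_bound (aestronglyMeasurable_volterraFun hm hφ f) ‖f‖
    (ae_mem_Icc_muI.mono fun _ hx => norm_volterraFun_le hφ f hx)

/-- For a measurable `φ : [0,1] → [0,1]`, the bounded operator `V_φ` on `L²(0,1)`,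
`(V_φ f)(x) = ∫_0^{φ(x)} f(t) dt`. -/
def volterraOp (φ : ℝ → ℝ) (hm : Measurable φ) (hφ : MapsTo φ (Icc 0 1) (Icc 0 1)) :
    L2I →L[ℂ] L2I :=
  LinearMap.mkContinuous
    { toFun := fun f => (memLp_volterraFun hm hφ f).toLp (volterraFun φ f)
      map_add' := by
        intro f g
        rw [← MemLp.toLp_add, MemLp.toLp_eq_toLp_iff]
        filter_upwards [ae_mem_Icc_muI] with x hx
        rw [volterraFun_congr hφ (Lp.coeFn_add f g) hx]
        exact intervalIntegral.integral_add (L2I_intervalIntegrable f (hφ hx))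
          (L2I_intervalIntegrable g (hφ hx))
      map_smul' := by
        intro c f
        rw [RingHom.id_apply, ← MemLp.toLp_const_smul, MemLp.toLp_eq_toLp_iff]
        filter_upwards [ae_mem_Icc_muI] with x hx
        rw [volterraFun_congr hφ (Lp.coeFn_smul c f) hx]
        exact intervalIntegral.integral_smul c _ }
    1 (by
      intro f
      have h := Lp.norm_le_of_ae_bound (f := (memLp_volterraFun hm hφ f).toLp (volterraFun φ f))
        (norm_nonneg f) (by
          filter_upwards [ae_mem_Icc_muI, (memLp_volterraFun hm hφ f).coeFn_toLp] with x hx h2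
          rw [h2]
          exact norm_volterraFun_le hφ f hx)
      simpa [measureUnivNNReal] using h)

theorem volterraOp_coeFn (φ : ℝ → ℝ) (hm : Measurable φ) (hφ : MapsTo φ (Icc 0 1) (Icc 0 1))
    (f : L2I) : volterraOp φ hm hφ f =ᵐ[muI] fun x => ∫ t in (0 : ℝ)..(φ x), f t :=
  (memLp_volterraFun hm hφ f).coeFn_toLp

theorem measurable_powFun (α : ℝ) : Measurable fun x : ℝ => x ^ α := by
  fun_prop

theorem mapsTo_powFun {α : ℝ} (h0 : 0 < α) :
    MapsTo (fun x : ℝ => x ^ α) (Icc 0 1) (Icc 0 1) := fun _ hx =>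
  ⟨Real.rpow_nonneg hx.1 _, Real.rpow_le_one hx.1 hx.2 h0.le⟩

theorem measurable_reflPowFun (α : ℝ) : Measurable fun x : ℝ => 1 - (1 - x) ^ (1 / α) := by
  fun_prop

theorem mapsTo_reflPowFun {α : ℝ} (h0 : 0 < α) :
    MapsTo (fun x : ℝ => 1 - (1 - x) ^ (1 / α)) (Icc 0 1) (Icc 0 1) := by
  intro x hx
  have h := mapsTo_powFun (one_div_pos.2 h0) (x := 1 - x)
    ⟨by linarith [hx.2], by linarith [hx.1]⟩
  simp only [mem_Icc] at h ⊢
  constructor <;> linarith [h.1, h.2]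

/-- The point spectrum `σ_p(T)`: the set of eigenvalues of the bounded operator `T`. -/
def pointSpectrum (T : L2I →L[ℂ] L2I) : Set ℂ :=
  {μ : ℂ | Module.End.HasEigenvalue (T : L2I →ₗ[ℂ] L2I) μ}

end

/-!
By Fubini both `V_ψ^*` and `U⁻¹ V_φ U` are integral operators with `{0, 1}`-valued kernels, and
these kernels agree as soon as `y < ψ x ↔ 1 - x < φ (1 - y)`.

Let `q = 1 / α` and `φ x = 1 - (1 - x) ^ q`. If `V_φ f = μ f` with `f ≠ 0`, then `μ ≠ 0`, since
`φ` is onto, and the primitive `h` of `f` satisfies `μ h' = h ∘ φ`, `h 0 = 0`. The reflection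
`u x = h (1 - x)` solves `u' x = -μ⁻¹ u (x ^ q)`, `u 1 = 0`. The argument is delayed,
`x ^ q ≤ x`, so a Gronwall estimate makes `u` unique up to a scalar: it is a multiple of the series
`∑ z ^ k x ^ [k]_q / [k]_q!` with `z = -μ⁻¹`. Hence `μ` is an eigenvalue exactly when the
`q`-exponential vanishes at `-μ⁻¹`, and the functional equation
`qExp q (q z) = (1 + (q - 1) z) qExp q z` locates its zeros.
-/

open Filter
open scoped ComplexConjugate

theorem integral_sub_add_integral_comp_sub_left {E : Type*} [NormedAddCommGroup E]
    [NormedSpace ℝ E] {k : ℝ → E} {c x : ℝ} (hk : IntervalIntegrable k volume 0 c)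
    (hx : x ∈ Icc 0 c) :
    (∫ t in (0 : ℝ)..(c - x), k t) + ∫ t in (0 : ℝ)..x, k (c - t) = ∫ t in (0 : ℝ)..c, k t := by
  have hmem : c - x ∈ uIcc 0 c := by
    rw [uIcc_of_le (hx.1.trans hx.2)]
    exact ⟨sub_nonneg.2 hx.2, sub_le_self c hx.1⟩
  rw [intervalIntegral.integral_comp_sub_left, sub_zero]
  exact intervalIntegral.integral_add_adjacent_intervals
    (hk.mono_set (uIcc_subset_uIcc_left hmem)) (hk.mono_set (uIcc_subset_uIcc_right hmem))

theorem eq_zero_of_norm_le_mul_norm_integral_comp {E : Type*} [NormedAddCommGroup E]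
    [NormedSpace ℝ E] {χ : ℝ → ℝ} {u : ℝ → E} {b K : ℝ} (hχ : ∀ t ∈ Icc 0 b, χ t ∈ Icc 0 t)
    (hu : ContinuousOn u (Icc 0 b))
    (h : ∀ x ∈ Icc 0 b, ‖u x‖ ≤ K * ‖∫ t in (0 : ℝ)..x, u (χ t)‖) {x : ℝ} (hx : x ∈ Icc 0 b) :
    u x = 0 := by
  set L : ℝ := |K| + 1
  have hL : 0 < L := by positivity
  -- Bielecki's weight `exp (-L x)` makes the right-hand side a strict contraction.
  obtain ⟨m, hm, hmax⟩ := isCompact_Icc.exists_isMaxOn ⟨x, hx⟩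
    (f := fun x => ‖u x‖ * Real.exp (-(L * x))) (by fun_prop)
  set A : ℝ := ‖u m‖ * Real.exp (-(L * m))
  have hA : 0 ≤ A := by positivity
  have hbound : ∀ t ∈ Icc 0 b, ‖u t‖ ≤ A * Real.exp (L * t) := fun t ht => by
    have := isMaxOn_iff.1 hmax t ht
    rwa [Real.exp_neg, ← div_eq_mul_inv, div_le_iff₀ (Real.exp_pos _)] at this
  have hdelay : ∀ t ∈ Ioc 0 m, ‖u (χ t)‖ ≤ A * Real.exp (L * t) := fun t ht => by
    have hχt := hχ t ⟨ht.1.le, ht.2.trans hm.2⟩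
    refine (hbound _ ⟨hχt.1, hχt.2.trans (ht.2.trans hm.2)⟩).trans ?_
    gcongr
    exact hχt.2
  have hintegral : ‖∫ t in (0 : ℝ)..m, u (χ t)‖ ≤ A * (L⁻¹ * (Real.exp (L * m) - 1)) := by
    refine (intervalIntegral.norm_integral_le_of_norm_le hm.1 (.of_forall hdelay)
      (Continuous.intervalIntegrable (by fun_prop) _ _)).trans_eq ?_
    simp [intervalIntegral.integral_comp_mul_left _ hL.ne', integral_exp]
  have hself : A * Real.exp (L * m) ≤ A * (Real.exp (L * m) - 1) := calc
    A * Real.exp (L * m) = ‖u m‖ := by rw [mul_assoc, ← Real.exp_add, neg_add_cancel]; simp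
    _ ≤ K * ‖∫ t in (0 : ℝ)..m, u (χ t)‖ := h m hm
    _ ≤ L * (A * (L⁻¹ * (Real.exp (L * m) - 1))) := by
      gcongr
      linarith [le_abs_self K]
    _ = A * (Real.exp (L * m) - 1) := by field_simp
  have hA0 : A = 0 := by linarith
  simpa [hA0] using hbound x hx

section QExponential

open scoped Nat

variable {q : ℝ}

/-- The `q`-number `[k]_q = 1 + q + ⋯ + q ^ (k - 1)`, with `[0]_q = 0`. -/
noncomputable def qNumber (q : ℝ) (k : ℕ) : ℝ := ∑ i ∈ Finset.range k, q ^ i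

/-- The `q`-factorial `[1]_q [2]_q ⋯ [k]_q`. -/
noncomputable def qFactorial (q : ℝ) (k : ℕ) : ℝ := ∏ j ∈ Finset.range k, qNumber q (j + 1)

/-- The `q`-exponential `∑ z ^ k / [k]_q!`, an entire function of `z` for `1 ≤ q`. -/
noncomputable def qExp (q : ℝ) (z : ℂ) : ℂ := ∑' k, z ^ k / qFactorial q k

theorem qNumber_zero : qNumber q 0 = 0 := by
  simp [qNumber]

theorem qNumber_succ (k : ℕ) : qNumber q (k + 1) = q * qNumber q k + 1 :=
  geom_sum_succ

theorem qNumber_nonneg (hq : 0 ≤ q) (k : ℕ) : 0 ≤ qNumber q k :=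
  Finset.sum_nonneg fun _ _ => pow_nonneg hq _

theorem qNumber_succ_pos (hq : 0 ≤ q) (k : ℕ) : 0 < qNumber q (k + 1) :=
  geom_sum_pos hq k.succ_ne_zero

theorem natCast_le_qNumber (hq : 1 ≤ q) (k : ℕ) : (k : ℝ) ≤ qNumber q k := by
  simpa [qNumber] using
    Finset.card_nsmul_le_sum (Finset.range k) (q ^ ·) 1 fun _ _ => one_le_pow₀ hq

theorem qFactorial_zero : qFactorial q 0 = 1 := by
  simp [qFactorial]

theorem qFactorial_succ (k : ℕ) : qFactorial q (k + 1) = qFactorial q k * qNumber q (k + 1) :=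
  Finset.prod_range_succ _ _

theorem qFactorial_pos (hq : 0 ≤ q) (k : ℕ) : 0 < qFactorial q k :=
  Finset.prod_pos fun _ _ => qNumber_succ_pos hq _

theorem factorial_le_qFactorial (hq : 1 ≤ q) (k : ℕ) : (k ! : ℝ) ≤ qFactorial q k := by
  rw [← Finset.prod_range_add_one_eq_factorial, Nat.cast_prod]
  exact Finset.prod_le_prod (fun _ _ => Nat.cast_nonneg _) fun _ _ => natCast_le_qNumber hq _

theorem norm_pow_div_qFactorial_le (hq : 1 ≤ q) (z : ℂ) (k : ℕ) :
    ‖z ^ k / qFactorial q k‖ ≤ ‖z‖ ^ k / k ! := by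
  rw [norm_div, norm_pow, Complex.norm_real,
    Real.norm_of_nonneg (qFactorial_pos (zero_le_one.trans hq) k).le]
  gcongr
  exact factorial_le_qFactorial hq k

theorem summable_norm_pow_div_qFactorial (hq : 1 ≤ q) (z : ℂ) :
    Summable fun k => ‖z ^ k / qFactorial q k‖ :=
  .of_nonneg_of_le (fun _ => norm_nonneg _) (norm_pow_div_qFactorial_le hq z)
    (Real.summable_pow_div_factorial ‖z‖)

theorem qExp_zero : qExp q 0 = 1 := by
  rw [qExp, tsum_eq_single 0 fun k hk => by simp [hk]]
  simp [qFactorial_zero]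

theorem continuous_qExp (hq : 1 ≤ q) : Continuous (qExp q) := by
  refine continuous_iff_continuousAt.2 fun z => ?_
  have hball : ContinuousOn (qExp q) (Metric.ball 0 (‖z‖ + 1)) := by
    refine continuousOn_tsum (fun k => by fun_prop)
      (Real.summable_pow_div_factorial (‖z‖ + 1)) fun k w hw => ?_
    refine (norm_pow_div_qFactorial_le hq w k).trans ?_
    gcongr
    exact (mem_ball_zero_iff.1 hw).le
  exact hball.continuousAt (Metric.isOpen_ball.mem_nhds (by simp))

theorem mul_pow_succ_div_qFactorial_succ (hq : 0 ≤ q) (z : ℂ) (k : ℕ) :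
    (q * z) ^ (k + 1) / qFactorial q (k + 1) =
      z ^ (k + 1) / qFactorial q (k + 1) + (q - 1) * z * (z ^ k / qFactorial q k) := by
  have hgeom : (qNumber q (k + 1) : ℂ) * (q - 1) = q ^ (k + 1) - 1 := by
    exact_mod_cast geom_sum_mul q (k + 1)
  have hfac : (qFactorial q k : ℂ) ≠ 0 := by exact_mod_cast (qFactorial_pos hq k).ne'
  have hnum : (qNumber q (k + 1) : ℂ) ≠ 0 := by exact_mod_cast (qNumber_succ_pos hq k).ne'
  rw [qFactorial_succ, Complex.ofReal_mul]
  field_simp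
  linear_combination -z ^ (k + 1) * hgeom

theorem qExp_mul_left (hq : 1 ≤ q) (z : ℂ) :
    qExp q (q * z) = (1 + (q - 1) * z) * qExp q z := by
  have hsum := fun w => (summable_norm_pow_div_qFactorial hq w).of_norm
  have hsplit := fun w => (hsum w).tsum_eq_zero_add
  simp only [pow_zero, qFactorial_zero, Complex.ofReal_one, div_one] at hsplit
  rw [qExp, hsplit,
    tsum_congr (mul_pow_succ_div_qFactorial_succ (zero_le_one.trans hq) z),
    ((summable_nat_add_iff 1).2 (hsum z)).tsum_add ((hsum z).mul_left _), tsum_mul_left,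
    ← add_assoc, ← hsplit, ← qExp]
  ring

theorem qExp_eq_prod_mul (hq : 1 ≤ q) (z : ℂ) (n : ℕ) :
    qExp q z = (∏ i ∈ Finset.range n, (1 + (q - 1) * (z / q ^ (i + 1)))) * qExp q (z / q ^ n) := by
  induction n with
  | zero => simp
  | succ n ih =>
    have hq0 : (q : ℂ) ≠ 0 := by exact_mod_cast (zero_lt_one.trans_le hq).ne'
    have hscale : z / q ^ n = q * (z / q ^ (n + 1)) := by
      rw [pow_succ']
      field_simp
    rw [ih, hscale, qExp_mul_left hq, Finset.prod_range_succ, mul_assoc]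

theorem tendsto_qExp_div_pow (hq : 1 < q) (z : ℂ) :
    Tendsto (fun n : ℕ => qExp q (z / q ^ n)) atTop (nhds 1) := by
  have hinv : ‖(q : ℂ)⁻¹‖ < 1 := by
    rw [norm_inv, Complex.norm_real, Real.norm_of_nonneg (zero_le_one.trans hq.le)]
    exact inv_lt_one_of_one_lt₀ hq
  have harg : Tendsto (fun n : ℕ => z / (q : ℂ) ^ n) atTop (nhds 0) := by
    simpa [div_eq_mul_inv] using (tendsto_pow_atTop_nhds_zero_of_norm_lt_one hinv).const_mul z
  simpa only [qExp_zero, Function.comp_def] using ((continuous_qExp hq.le).tendsto 0).comp harg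

theorem qExp_eq_zero_iff (hq : 1 < q) (z : ℂ) :
    qExp q z = 0 ↔ ∃ n : ℕ, 1 + (q - 1) * (z / q ^ (n + 1)) = 0 := by
  refine ⟨fun hz => ?_, fun ⟨n, hn⟩ => ?_⟩
  · by_contra! hne
    have hzero : ∀ n : ℕ, qExp q (z / q ^ n) = 0 := fun n =>
      (mul_eq_zero.1 ((qExp_eq_prod_mul hq.le z n).symm.trans hz)).resolve_left
        (Finset.prod_ne_zero_iff.2 fun i _ => hne i)
    refine zero_ne_one (tendsto_nhds_unique ?_ (tendsto_qExp_div_pow hq z))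
    simp only [hzero, tendsto_const_nhds]
  · rw [qExp_eq_prod_mul hq.le z (n + 1),
      Finset.prod_eq_zero (Finset.self_mem_range_succ n) hn, zero_mul]

end QExponential

section Pantograph

variable {q : ℝ}

/-- The series `∑ z ^ k x ^ [k]_q / [k]_q!`, which solves the pantograph-type equation
`G' x = z G (x ^ q)`, `G 0 = 1` on `[0, 1]`. -/
noncomputable def pantographSeries (q : ℝ) (z : ℂ) (x : ℝ) : ℂ :=
  ∑' k, z ^ k / qFactorial q k * (x ^ qNumber q k : ℝ)

theorem pantographSeries_one (z : ℂ) : pantographSeries q z 1 = qExp q z := by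
  simp [pantographSeries, qExp]

theorem norm_mul_rpow_qNumber_le (hq : 0 ≤ q) (c : ℂ) (k : ℕ) {x : ℝ} (hx : x ∈ Icc (0 : ℝ) 1) :
    ‖c * (x ^ qNumber q k : ℝ)‖ ≤ ‖c‖ := by
  rw [norm_mul, Complex.norm_real, Real.norm_of_nonneg (Real.rpow_nonneg hx.1 _)]
  exact mul_le_of_le_one_right (norm_nonneg c)
    (Real.rpow_le_one hx.1 hx.2 (qNumber_nonneg hq k))

theorem continuous_mul_rpow_qNumber (hq : 0 ≤ q) (c : ℂ) (k : ℕ) :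
    Continuous fun x : ℝ => c * (x ^ qNumber q k : ℝ) :=
  continuous_const.mul
    (Complex.continuous_ofReal.comp (Real.continuous_rpow_const (qNumber_nonneg hq k)))

theorem hasSum_pantographSeries (hq : 1 ≤ q) (z : ℂ) {x : ℝ} (hx : x ∈ Icc (0 : ℝ) 1) :
    HasSum (fun k => z ^ k / qFactorial q k * (x ^ qNumber q k : ℝ)) (pantographSeries q z x) :=
  (Summable.of_norm_bounded (summable_norm_pow_div_qFactorial hq z)
    fun k => norm_mul_rpow_qNumber_le (zero_le_one.trans hq) _ k hx).hasSum

theorem continuousOn_pantographSeries (hq : 1 ≤ q) (z : ℂ) :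
    ContinuousOn (pantographSeries q z) (Icc 0 1) :=
  continuousOn_tsum
    (fun k => (continuous_mul_rpow_qNumber (zero_le_one.trans hq) _ k).continuousOn)
    (summable_norm_pow_div_qFactorial hq z)
    fun k _ hx => norm_mul_rpow_qNumber_le (zero_le_one.trans hq) _ k hx

theorem integral_rpow_rpow_qNumber (hq : 0 ≤ q) (k : ℕ) {x : ℝ} (hx : 0 ≤ x) :
    ∫ t in (0 : ℝ)..x, (t ^ q) ^ qNumber q k = x ^ qNumber q (k + 1) / qNumber q (k + 1) := by
  have hexp : 0 ≤ q * qNumber q k := mul_nonneg hq (qNumber_nonneg hq k)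
  have hpow : ∀ t ∈ uIcc 0 x, (t ^ q) ^ qNumber q k = t ^ (q * qNumber q k) := fun t ht => by
    rw [uIcc_of_le hx] at ht
    exact (Real.rpow_mul ht.1 _ _).symm
  rw [intervalIntegral.integral_congr hpow, integral_rpow (.inl (by linarith)), ← qNumber_succ,
    Real.zero_rpow (qNumber_succ_pos hq k).ne', sub_zero]

theorem mul_integral_pantographSeries_term (hq : 0 ≤ q) (z : ℂ) (k : ℕ) {x : ℝ} (hx : 0 ≤ x) :
    z * ∫ t in (0 : ℝ)..x, z ^ k / qFactorial q k * ((t ^ q) ^ qNumber q k : ℝ) =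
      z ^ (k + 1) / qFactorial q (k + 1) * (x ^ qNumber q (k + 1) : ℝ) := by
  rw [intervalIntegral.integral_const_mul, intervalIntegral.integral_ofReal,
    integral_rpow_rpow_qNumber hq k hx, qFactorial_succ]
  push_cast
  ring

theorem pantographSeries_eq_one_add (hq : 1 ≤ q) (z : ℂ) {x : ℝ} (hx : x ∈ Icc (0 : ℝ) 1) :
    pantographSeries q z x = 1 + z * ∫ t in (0 : ℝ)..x, pantographSeries q z (t ^ q) := by
  have hq0 : 0 < q := zero_lt_one.trans_le hq
  have hpow : ∀ t ∈ uIoc 0 x, t ^ q ∈ Icc (0 : ℝ) 1 := fun t ht => by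
    rw [uIoc_of_le hx.1] at ht
    exact mapsTo_powFun hq0 ⟨ht.1.le, ht.2.trans hx.2⟩
  have hintegral : HasSum
      (fun k => ∫ t in (0 : ℝ)..x, z ^ k / qFactorial q k * ((t ^ q) ^ qNumber q k : ℝ))
      (∫ t in (0 : ℝ)..x, pantographSeries q z (t ^ q)) :=
    intervalIntegral.hasSum_integral_of_dominated_convergence
      (fun k _ => ‖z ^ k / qFactorial q k‖)
      (fun k => ((continuous_mul_rpow_qNumber hq0.le _ k).comp
        (Real.continuous_rpow_const hq0.le)).aestronglyMeasurable)
      (fun k => .of_forall fun t ht => norm_mul_rpow_qNumber_le hq0.le _ k (hpow t ht))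
      (.of_forall fun _ _ => summable_norm_pow_div_qFactorial hq z)
      intervalIntegrable_const
      (.of_forall fun t ht => hasSum_pantographSeries hq z (hpow t ht))
  rw [← hintegral.tsum_eq, ← tsum_mul_left,
    tsum_congr fun k => mul_integral_pantographSeries_term hq0.le z k hx.1, pantographSeries,
    (hasSum_pantographSeries hq z hx).summable.tsum_eq_zero_add]
  simp [qNumber_zero, qFactorial_zero]

end Pantograph

section UnitInterval

theorem one_sub_mem_Icc_zero_one {x : ℝ} (hx : x ∈ Icc (0 : ℝ) 1) : 1 - x ∈ Icc (0 : ℝ) 1 :=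
  ⟨sub_nonneg.2 hx.2, sub_le_self 1 hx.1⟩

theorem measurePreserving_one_sub_muI : MeasurePreserving (fun x : ℝ => 1 - x) muI muI := by
  simpa using (Measure.measurePreserving_sub_left (volume : Measure ℝ) 1).restrict_preimage
    (measurableSet_Ioo (a := (0 : ℝ)) (b := 1))

theorem integral_prod_muI_one_sub_swap (F : ℝ × ℝ → ℂ) :
    ∫ p, F (1 - p.2, 1 - p.1) ∂(muI.prod muI) = ∫ p, F p ∂(muI.prod muI) := by
  let e : ℝ × ℝ ≃ᵐ ℝ × ℝ :=
    MeasurableEquiv.ofInvolutive (fun p => (1 - p.2, 1 - p.1)) (fun p => by simp) (by fun_prop)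
  have he : MeasurePreserving e (muI.prod muI) (muI.prod muI) :=
    (measurePreserving_one_sub_muI.prod measurePreserving_one_sub_muI).comp
      Measure.measurePreserving_swap
  exact he.integral_comp' F

theorem intervalIntegral_eq_integral_indicator_Iio (f : ℝ → ℂ) {c : ℝ} (hc : c ∈ Icc (0 : ℝ) 1) :
    ∫ t in (0 : ℝ)..c, f t = ∫ t, (Iio c).indicator f t ∂muI := by
  have hinter : Iio c ∩ Ioo (0 : ℝ) 1 = Ioo 0 c := by
    rw [inter_comm, Ioo_inter_Iio, min_eq_right hc.2]
  rw [integral_indicator measurableSet_Iio, Measure.restrict_restrict measurableSet_Iio, hinter,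
    intervalIntegral.integral_of_le hc.1, integral_Ioc_eq_integral_Ioo]

theorem intervalIntegral_congr_muI {f g : ℝ → ℂ} (h : f =ᵐ[muI] g) {x : ℝ}
    (hx : x ∈ Icc (0 : ℝ) 1) : ∫ t in (0 : ℝ)..x, f t = ∫ t in (0 : ℝ)..x, g t :=
  volterraFun_congr (mapsTo_id _) h hx

theorem memLp_comp_muI {E : Type*} [NormedAddCommGroup E] {p : ENNReal} {φ : ℝ → ℝ} {h : ℝ → E}
    (hm : Measurable φ) (hφ : MapsTo φ (Icc 0 1) (Icc 0 1)) (hh : ContinuousOn h (Icc 0 1)) :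
    MemLp (h ∘ φ) p muI := by
  have hext : Continuous (IccExtend zero_le_one ((Icc 0 1).domRestrict h)) :=
    hh.domRestrict.Icc_extend'
  have hmeas : AEStronglyMeasurable (h ∘ φ) muI := by
    refine (hext.stronglyMeasurable.comp_measurable hm).aestronglyMeasurable.congr ?_
    filter_upwards [ae_mem_Icc_muI] with x hx
    exact IccExtend_of_mem zero_le_one _ (hφ hx)
  obtain ⟨B, hB⟩ := isCompact_Icc.exists_bound_of_continuousOn hh
  exact .of_bound hmeas B (ae_mem_Icc_muI.mono fun x hx => hB _ (hφ hx))

theorem continuousOn_primitive_L2I (f : L2I) :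
    ContinuousOn (fun x => ∫ t in (0 : ℝ)..x, f t) (Icc 0 1) := by
  simpa only [uIcc_of_le zero_le_one] using intervalIntegral.continuousOn_primitive_interval'
    (L2I_intervalIntegrable f (right_mem_Icc.2 zero_le_one)) left_mem_uIcc

theorem L2I_eq_zero_of_integral_eq_zero {f : L2I}
    (h : ∀ x ∈ Icc (0 : ℝ) 1, ∫ t in (0 : ℝ)..x, f t = 0) : f = 0 := by
  have hintegral := L2I_intervalIntegrable f (right_mem_Icc.2 zero_le_one)
  rw [Lp.eq_zero_iff_ae_eq_zero]
  filter_upwards [ae_restrict_of_ae hintegral.ae_hasDerivAt_integral,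
    ae_restrict_mem measurableSet_Ioo] with x hderiv hx
  have hf := hderiv (by simpa using Ioo_subset_Icc_self hx) 0 left_mem_uIcc
  refine hf.unique ((hasDerivAt_const x (0 : ℂ)).congr_of_eventuallyEq ?_)
  filter_upwards [Icc_mem_nhds hx.1 hx.2] with y hy using h y hy

end UnitInterval

section Adjoint

/-- The unitary operator `(U f)(x) = f (1 - x)` on `L²(0,1)`. -/
noncomputable def reflectL2 : L2I ≃ₗᵢ[ℂ] L2I :=
  let U := Lp.compMeasurePreservingₗᵢ ℂ (fun x : ℝ => 1 - x) measurePreserving_one_sub_muI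
  .ofSurjective U fun f => ⟨U f, by
    change Lp.compMeasurePreserving _ _ (Lp.compMeasurePreserving _ _ f) = f
    rw [← Lp.compMeasurePreserving_comp_apply]
    simp⟩

theorem reflectL2_coeFn (f : L2I) : reflectL2 f =ᵐ[muI] fun x => f (1 - x) :=
  Lp.coeFn_compMeasurePreserving f measurePreserving_one_sub_muI

theorem inner_volterraOp {φ : ℝ → ℝ} (hm : Measurable φ) (hφ : MapsTo φ (Icc 0 1) (Icc 0 1))
    (g f : L2I) :
    inner ℂ g (volterraOp φ hm hφ f) =
      ∫ p, {p : ℝ × ℝ | p.2 < φ p.1}.indicator (fun p => f p.2 * conj (g p.1)) p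
        ∂(muI.prod muI) := by
  have hg : Integrable (fun x => conj (g x)) muI :=
    (L2I_integrable g).congr' (Complex.continuous_conj.comp_aestronglyMeasurable
      (Lp.aestronglyMeasurable g)) (.of_forall fun x => (RCLike.norm_conj (g x)).symm)
  have hintegral : Integrable ({p : ℝ × ℝ | p.2 < φ p.1}.indicator fun p => f p.2 * conj (g p.1))
      (muI.prod muI) := by
    refine Integrable.indicator ?_ (measurableSet_lt measurable_snd (hm.comp measurable_fst))
    simpa only [mul_comm] using hg.mul_prod (L2I_integrable f)
  rw [integral_prod _ hintegral, L2.inner_def]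
  refine integral_congr_ae ?_
  filter_upwards [volterraOp_coeFn φ hm hφ f, ae_mem_Icc_muI] with x hx hxI
  rw [RCLike.inner_apply, hx, intervalIntegral_eq_integral_indicator_Iio _ (hφ hxI),
    ← integral_mul_const]
  simp only [indicator, mem_Iio, mem_ofPred_eq, ite_mul, zero_mul]

theorem inner_reflectL2_volterraOp_reflectL2 {φ : ℝ → ℝ} (hm : Measurable φ)
    (hφ : MapsTo φ (Icc 0 1) (Icc 0 1)) (g f : L2I) :
    inner ℂ (reflectL2 g) (volterraOp φ hm hφ (reflectL2 f)) =
      ∫ p, {p : ℝ × ℝ | 1 - p.1 < φ (1 - p.2)}.indicator (fun p => f p.1 * conj (g p.2)) p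
        ∂(muI.prod muI) := by
  have hg := Measure.quasiMeasurePreserving_fst (μ := muI) (ν := muI) |>.ae_eq_comp
    (reflectL2_coeFn g)
  have hf := Measure.quasiMeasurePreserving_snd (μ := muI) (ν := muI) |>.ae_eq_comp
    (reflectL2_coeFn f)
  rw [inner_volterraOp]
  refine .trans (integral_congr_ae ?_) (integral_prod_muI_one_sub_swap _)
  filter_upwards [hf, hg] with p hfp hgp
  simp only [Function.comp_apply] at hfp hgp
  simp only [indicator, mem_ofPred_eq, sub_sub_cancel, hfp, hgp]

theorem adjoint_volterraOp {ψ φ : ℝ → ℝ} (hmψ : Measurable ψ)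
    (hψ : MapsTo ψ (Icc 0 1) (Icc 0 1)) (hmφ : Measurable φ) (hφ : MapsTo φ (Icc 0 1) (Icc 0 1))
    (h : ∀ x ∈ Icc (0 : ℝ) 1, ∀ y ∈ Icc (0 : ℝ) 1, y < ψ x ↔ 1 - x < φ (1 - y)) (f : L2I) :
    ContinuousLinearMap.adjoint (volterraOp ψ hmψ hψ) f =
      reflectL2.symm (volterraOp φ hmφ hφ (reflectL2 f)) := by
  refine ext_inner_left ℂ fun g => ?_
  rw [ContinuousLinearMap.adjoint_inner_right, ← inner_conj_symm, inner_volterraOp,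
    ← integral_conj, ← LinearIsometryEquiv.inner_map_map reflectL2,
    LinearIsometryEquiv.apply_symm_apply, inner_reflectL2_volterraOp_reflectL2]
  refine integral_congr_ae ?_
  filter_upwards [Measure.quasiMeasurePreserving_fst.ae ae_mem_Icc_muI,
    Measure.quasiMeasurePreserving_snd.ae ae_mem_Icc_muI] with p hp₁ hp₂
  simp only [indicator, mem_ofPred_eq, h _ hp₁ _ hp₂]
  split_ifs <;> simp [mul_comm]

end Adjoint

section PointSpectrum

/-- `h` is a nonzero continuous solution of `μ h(x) = ∫_0^x h(φ(t)) dt` on `[0, 1]`. For `μ ≠ 0`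
these are the primitives vanishing at `0` of the eigenvectors of `V_φ` for `μ`. -/
structure IsEigenprimitive (φ : ℝ → ℝ) (μ : ℂ) (h : ℝ → ℂ) : Prop where
  continuousOn : ContinuousOn h (Icc 0 1)
  exists_ne_zero : ∃ x ∈ Icc (0 : ℝ) 1, h x ≠ 0
  mul_eq_integral : ∀ x ∈ Icc (0 : ℝ) 1, μ * h x = ∫ t in (0 : ℝ)..x, h (φ t)

theorem mem_pointSpectrum_iff {T : L2I →L[ℂ] L2I} {μ : ℂ} :
    μ ∈ pointSpectrum T ↔ ∃ f : L2I, f ≠ 0 ∧ T f = μ • f := by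
  refine ⟨fun h => ?_, fun ⟨f, hf, hT⟩ => ?_⟩
  · obtain ⟨f, hf⟩ := Module.End.HasEigenvalue.exists_hasEigenvector h
    exact ⟨f, hf.2, hf.apply_eq_smul⟩
  · exact Module.End.hasEigenvalue_of_hasEigenvector ⟨Module.End.mem_eigenspace_iff.2 hT, hf⟩

variable {φ : ℝ → ℝ} {μ : ℂ} (hm : Measurable φ) (hφ : MapsTo φ (Icc 0 1) (Icc 0 1))

theorem smul_coeFn_eq_primitive_comp {f : L2I} (hf : volterraOp φ hm hφ f = μ • f) :
    (fun x => μ * f x) =ᵐ[muI] fun x => ∫ t in (0 : ℝ)..(φ x), f t := by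
  filter_upwards [volterraOp_coeFn φ hm hφ f, Lp.coeFn_smul μ f] with x hV hsmul
  rw [← hV, hf, hsmul, Pi.smul_apply, smul_eq_mul]

theorem isEigenprimitive_primitive {f : L2I} (hf0 : f ≠ 0)
    (hf : volterraOp φ hm hφ f = μ • f) :
    IsEigenprimitive φ μ fun x => ∫ t in (0 : ℝ)..x, f t where
  continuousOn := continuousOn_primitive_L2I f
  exists_ne_zero := by
    by_contra! hzero
    exact hf0 (L2I_eq_zero_of_integral_eq_zero hzero)
  mul_eq_integral x hx := by
    rw [← intervalIntegral.integral_const_mul]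
    exact intervalIntegral_congr_muI (smul_coeFn_eq_primitive_comp hm hφ hf) hx

theorem IsEigenprimitive.mem_pointSpectrum {h : ℝ → ℂ} (hh : IsEigenprimitive φ μ h)
    (hμ : μ ≠ 0) : μ ∈ pointSpectrum (volterraOp φ hm hφ) := by
  have hmem : MemLp (h ∘ φ) 2 muI := memLp_comp_muI hm hφ hh.continuousOn
  have hprim : ∀ x ∈ Icc (0 : ℝ) 1, ∫ t in (0 : ℝ)..x, hmem.toLp (h ∘ φ) t = μ * h x :=
    fun x hx => (intervalIntegral_congr_muI hmem.coeFn_toLp hx).trans (hh.mul_eq_integral x hx).symm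
  refine mem_pointSpectrum_iff.2 ⟨hmem.toLp (h ∘ φ), fun hzero => ?_, Lp.ext ?_⟩
  · obtain ⟨x, hx, hne⟩ := hh.exists_ne_zero
    refine mul_ne_zero hμ hne ?_
    rw [← hprim x hx, hzero, intervalIntegral_congr_muI (Lp.coeFn_zero ℂ 2 muI) hx]
    simp
  · filter_upwards [volterraOp_coeFn φ hm hφ (hmem.toLp (h ∘ φ)), ae_mem_Icc_muI,
      Lp.coeFn_smul μ (hmem.toLp (h ∘ φ)), hmem.coeFn_toLp] with x hV hx hsmul hcoe
    rw [hV, hprim _ (hφ hx), hsmul, Pi.smul_apply, hcoe, smul_eq_mul, Function.comp_apply]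

theorem zero_notMem_pointSpectrum_volterraOp (hc : ContinuousOn φ (Icc 0 1))
    (hs : SurjOn φ (Icc 0 1) (Icc 0 1)) : (0 : ℂ) ∉ pointSpectrum (volterraOp φ hm hφ) := by
  rw [mem_pointSpectrum_iff]
  rintro ⟨f, hf0, hf⟩
  have hae := (smul_coeFn_eq_primitive_comp hm hφ hf).symm
  have hzero : EqOn (fun x => ∫ t in (0 : ℝ)..(φ x), f t) (fun x => 0 * f x) (Icc 0 1) :=
    Measure.eqOn_Icc_of_ae_eq volume zero_ne_one
      (by rwa [← Measure.restrict_congr_set Ioo_ae_eq_Icc])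
      ((continuousOn_primitive_L2I f).comp hc hφ) (by simpa using continuousOn_const)
  refine hf0 (L2I_eq_zero_of_integral_eq_zero fun y hy => ?_)
  obtain ⟨x, hx, rfl⟩ := hs hy
  simpa using hzero hx

end PointSpectrum

section PowerSymbol

variable {q : ℝ} {μ : ℂ}

theorem surjOn_one_sub_one_sub_rpow (hq : 0 < q) :
    SurjOn (fun x : ℝ => 1 - (1 - x) ^ q) (Icc 0 1) (Icc 0 1) := fun y hy => by
  have hy' := one_sub_mem_Icc_zero_one hy
  refine ⟨1 - (1 - y) ^ q⁻¹, one_sub_mem_Icc_zero_one (mapsTo_powFun (inv_pos.2 hq) hy'), ?_⟩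
  simp [Real.rpow_inv_rpow hy'.1 hq.ne']

theorem IsEigenprimitive.reflect_eq {h : ℝ → ℂ}
    (hh : IsEigenprimitive (fun x => 1 - (1 - x) ^ q) μ h) (hq : 0 < q) (hμ : μ ≠ 0) {x : ℝ}
    (hx : x ∈ Icc (0 : ℝ) 1) :
    h (1 - x) = h 1 + -μ⁻¹ * ∫ t in (0 : ℝ)..x, h (1 - t ^ q) := by
  have hmaps : MapsTo (fun t : ℝ => 1 - (1 - t) ^ q) (Icc 0 1) (Icc 0 1) := fun t ht =>
    one_sub_mem_Icc_zero_one (mapsTo_powFun hq (one_sub_mem_Icc_zero_one ht))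
  have hcont : ContinuousOn (fun t : ℝ => h (1 - (1 - t) ^ q)) (Icc 0 1) :=
    hh.continuousOn.comp (Continuous.continuousOn (by fun_prop (disch := exact hq.le))) hmaps
  have hsplit := integral_sub_add_integral_comp_sub_left
    (hcont.intervalIntegrable_of_Icc zero_le_one) hx
  simp only [sub_sub_cancel] at hsplit
  rw [← hh.mul_eq_integral _ (one_sub_mem_Icc_zero_one hx),
    ← hh.mul_eq_integral 1 (right_mem_Icc.2 zero_le_one)] at hsplit
  field_simp
  linear_combination hsplit

theorem IsEigenprimitive.reflect_eq_mul_pantographSeries {h : ℝ → ℂ}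
    (hh : IsEigenprimitive (fun x => 1 - (1 - x) ^ q) μ h) (hq : 1 ≤ q) (hμ : μ ≠ 0) {x : ℝ}
    (hx : x ∈ Icc (0 : ℝ) 1) : h (1 - x) = h 1 * pantographSeries q (-μ⁻¹) x := by
  have hq0 : 0 < q := zero_lt_one.trans_le hq
  set d : ℝ → ℂ := fun x => h (1 - x) - h 1 * pantographSeries q (-μ⁻¹) x
  have hreflect : ContinuousOn (fun x => h (1 - x)) (Icc 0 1) :=
    hh.continuousOn.comp (by fun_prop) fun _ => one_sub_mem_Icc_zero_one
  have hseries := continuousOn_pantographSeries hq (-μ⁻¹)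
  have hdcont : ContinuousOn d (Icc 0 1) := hreflect.sub (hseries.const_mul _)
  have hpow : ContinuousOn (fun t : ℝ => t ^ q) (Icc 0 1) :=
    (Real.continuous_rpow_const hq0.le).continuousOn
  have hd : ∀ x ∈ Icc (0 : ℝ) 1, d x = -μ⁻¹ * ∫ t in (0 : ℝ)..x, d (t ^ q) := fun x hx => by
    have hintegral : ∀ {g : ℝ → ℂ}, ContinuousOn g (Icc 0 1) →
        IntervalIntegrable (fun t => g (t ^ q)) volume 0 x := fun hg =>
      ((hg.comp hpow (mapsTo_powFun hq0)).mono
        (Icc_subset_Icc_right hx.2)).intervalIntegrable_of_Icc hx.1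
    rw [intervalIntegral.integral_sub (hintegral hreflect) ((hintegral hseries).const_mul _),
      intervalIntegral.integral_const_mul]
    linear_combination hh.reflect_eq hq0 hμ hx - h 1 * pantographSeries_eq_one_add hq (-μ⁻¹) hx
  have hdelay : ∀ t ∈ Icc (0 : ℝ) 1, t ^ q ∈ Icc 0 t := fun t ht =>
    ⟨Real.rpow_nonneg ht.1 q, Real.rpow_le_self_of_le_one ht.1 ht.2 hq⟩
  exact sub_eq_zero.1 <| eq_zero_of_norm_le_mul_norm_integral_comp hdelay hdcont
    (fun x hx => (congrArg norm (hd x hx)).trans_le (norm_mul_le _ _)) hx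

theorem IsEigenprimitive.qExp_eq_zero {h : ℝ → ℂ}
    (hh : IsEigenprimitive (fun x => 1 - (1 - x) ^ q) μ h) (hq : 1 ≤ q) (hμ : μ ≠ 0) :
    qExp q (-μ⁻¹) = 0 := by
  have hh0 : h 0 = 0 := by
    simpa [hμ] using hh.mul_eq_integral 0 (left_mem_Icc.2 zero_le_one)
  have hmul : h 1 * qExp q (-μ⁻¹) = 0 := by
    rw [← pantographSeries_one,
      ← hh.reflect_eq_mul_pantographSeries hq hμ (right_mem_Icc.2 zero_le_one), sub_self, hh0]
  refine (mul_eq_zero.1 hmul).resolve_left fun hh1 => ?_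
  obtain ⟨x, hx, hne⟩ := hh.exists_ne_zero
  have := hh.reflect_eq_mul_pantographSeries hq hμ (one_sub_mem_Icc_zero_one hx)
  exact hne (by simpa [hh1] using this)

theorem isEigenprimitive_pantographSeries (hq : 1 ≤ q) (hμ : μ ≠ 0)
    (hz : qExp q (-μ⁻¹) = 0) :
    IsEigenprimitive (fun x => 1 - (1 - x) ^ q) μ fun x => pantographSeries q (-μ⁻¹) (1 - x) where
  continuousOn := (continuousOn_pantographSeries hq _).comp (by fun_prop)
    fun _ => one_sub_mem_Icc_zero_one
  exists_ne_zero := ⟨1, right_mem_Icc.2 zero_le_one, by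
    simp [pantographSeries_eq_one_add hq (-μ⁻¹) (left_mem_Icc.2 zero_le_one)]⟩
  mul_eq_integral x hx := by
    have hcont : ContinuousOn (fun t => pantographSeries q (-μ⁻¹) (t ^ q)) (Icc 0 1) :=
      (continuousOn_pantographSeries hq _).comp
        (Real.continuous_rpow_const (by linarith)).continuousOn (mapsTo_powFun (by linarith))
    have hsplit := integral_sub_add_integral_comp_sub_left
      (hcont.intervalIntegrable_of_Icc zero_le_one) hx
    have hone := pantographSeries_eq_one_add hq (-μ⁻¹) (right_mem_Icc.2 zero_le_one)
    rw [pantographSeries_one, hz] at hone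
    simp only [sub_sub_cancel]
    rw [pantographSeries_eq_one_add hq (-μ⁻¹) (one_sub_mem_Icc_zero_one hx)]
    set G := pantographSeries q (-μ⁻¹)
    field_simp at hone ⊢
    linear_combination -hsplit - hone

theorem mem_pointSpectrum_volterraOp_reflPow_iff {α : ℝ} (h0 : 0 < α) (h1 : α ≤ 1) :
    μ ∈ pointSpectrum (volterraOp (fun x : ℝ => 1 - (1 - x) ^ (1 / α)) (measurable_reflPowFun α)
      (mapsTo_reflPowFun h0)) ↔ μ ≠ 0 ∧ qExp (1 / α) (-μ⁻¹) = 0 := by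
  have hq : 1 ≤ 1 / α := one_le_one_div h0 h1
  refine ⟨fun hμ => ?_, fun ⟨hμ, hz⟩ =>
    (isEigenprimitive_pantographSeries hq hμ hz).mem_pointSpectrum _ _ hμ⟩
  have hμ0 : μ ≠ 0 := by
    rintro rfl
    exact zero_notMem_pointSpectrum_volterraOp _ _
      (Continuous.continuousOn (by fun_prop (disch := positivity)))
      (surjOn_one_sub_one_sub_rpow (one_div_pos.2 h0)) hμ
  obtain ⟨f, hf0, hf⟩ := mem_pointSpectrum_iff.1 hμ
  exact ⟨hμ0, (isEigenprimitive_primitive _ _ hf0 hf).qExp_eq_zero hq hμ0⟩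

theorem qExp_one_div_neg_inv_eq_zero_iff {α : ℝ} (h0 : 0 < α) (h1 : α < 1) (hμ : μ ≠ 0) :
    qExp (1 / α) (-μ⁻¹) = 0 ↔ ∃ n : ℕ, μ = (1 - (α : ℂ)) * (α : ℂ) ^ n := by
  have hα : (α : ℂ) ≠ 0 := by exact_mod_cast h0.ne'
  rw [qExp_eq_zero_iff (one_lt_one_div h0 h1)]
  refine exists_congr fun n => ?_
  have hroot : 1 + (((1 / α : ℝ) : ℂ) - 1) * (-μ⁻¹ / ((1 / α : ℝ) : ℂ) ^ (n + 1)) =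
      (μ - (1 - α) * α ^ n) / μ := by
    rw [Complex.ofReal_div, Complex.ofReal_one, div_pow, one_pow, pow_succ]
    field_simp
    ring
  rw [hroot, div_eq_zero_iff, or_iff_left hμ, sub_eq_zero]

theorem mem_pointSpectrum_volterraOp_reflPow_iff_exists {α : ℝ} (h0 : 0 < α) (h1 : α < 1) :
    μ ∈ pointSpectrum (volterraOp (fun x : ℝ => 1 - (1 - x) ^ (1 / α)) (measurable_reflPowFun α)
      (mapsTo_reflPowFun h0)) ↔ ∃ n : ℕ, μ = (1 - (α : ℂ)) * (α : ℂ) ^ n := by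
  rw [mem_pointSpectrum_volterraOp_reflPow_iff h0 h1.le]
  refine ⟨fun ⟨hμ, hz⟩ => (qExp_one_div_neg_inv_eq_zero_iff h0 h1 hμ).1 hz, fun hn => ?_⟩
  have hμ : μ ≠ 0 := by
    obtain ⟨n, rfl⟩ := hn
    exact mul_ne_zero (sub_ne_zero.2 (by exact_mod_cast h1.ne'))
      (pow_ne_zero n (by exact_mod_cast h0.ne'))
  exact ⟨hμ, (qExp_one_div_neg_inv_eq_zero_iff h0 h1 hμ).2 hn⟩

end PowerSymbol

theorem corollary1 (α : ℝ) (h0 : 0 < α) (h1 : α < 1) :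
    (∃ U : L2I ≃ₗᵢ[ℂ] L2I,
      (∀ f : L2I, U f =ᵐ[muI] fun x => f (1 - x)) ∧
      ∀ f : L2I,
        ContinuousLinearMap.adjoint
            (volterraOp (fun x : ℝ => x ^ α) (measurable_powFun α) (mapsTo_powFun h0)) f =
          U.symm
            (volterraOp (fun x : ℝ => 1 - (1 - x) ^ (1 / α)) (measurable_reflPowFun α)
              (mapsTo_reflPowFun h0) (U f))) ∧
    pointSpectrum
        (volterraOp (fun x : ℝ => 1 - (1 - x) ^ (1 / α)) (measurable_reflPowFun α)
          (mapsTo_reflPowFun h0)) =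
      {μ : ℂ | ∃ n : ℕ, 1 ≤ n ∧ μ = (1 - (α : ℂ)) * (α : ℂ) ^ (n - 1)} := by
  refine ⟨⟨reflectL2, reflectL2_coeFn, adjoint_volterraOp _ _ _ _ fun x hx y hy => ?_⟩, ?_⟩
  · rw [sub_lt_sub_iff_left, sub_sub_cancel, one_div, Real.rpow_inv_lt_iff_of_pos hy.1 hx.1 h0]
  · ext μ
    rw [mem_pointSpectrum_volterraOp_reflPow_iff_exists h0 h1]
    exact ⟨fun ⟨n, hn⟩ => ⟨n + 1, Nat.le_add_left 1 n, hn⟩, fun ⟨n, _, hn⟩ => ⟨n - 1, hn⟩⟩
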